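/- All graphs are finite, undirected and simple. Let $G$ be a graph with $n$ vertices and minimum degree $\delta$. For disjoint $X,Y\subseteq V(G)$ let $e(X,Y)$ be the number of edges of $G$ with one end in $X$ and the other in $Y$, and let $\kappa'(G)$ be the edge connectivity of $G$, i.e. the least number of edges whose deletion leaves a graph that is not connected. Let $\mathcal{G}_2$ be the class of graphs $G$ that have three non-empty, pairwise disjoint, proper subsets $V_1,V_2,V_3\subset V(G)$ with $V(G)\setminus(V_1\cup V_2\cup V_3)\neq\emptyset$ and $e(V_i,V(G)\setminus V_i)=\kappa'(G)$ for $i=1,2,3$. For positive integers $k,d$, the graph $G$ has property $P(k,d)$ if it contains $k$ pairwise edge-disjoint spanning trees and a further forest $F$, edge-disjoint from these trees, with $|E(F)|>\frac{d-1}{d}(n-1)$, such that if $F$ is not a spanning tree of $G$, then some component of $F$ has at least $d$ edges. Let $\lambda_4(G)$ and $q_4(G)$ be the fourth largest eigenvalues, counted with multiplicity, of the adjacency matrix $A(G)$ and of the signless Laplacian matrix $Q(G)=D(G)+A(G)$, respectively, where $D(G)$ is the diagonal matrix of vertex degrees. **Corollary 4.3.** Let $k\ge 2$ be an integer and let $G\in\mathcal{G}_2$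 be a graph with minimum degree $\delta\ge 3k+3$. Then: (i) if $\lambda_4(G)<\delta-\dfrac{9\left(k+\frac{\delta-1}{\delta}\right)}{\delta+1}$, then $G$ has property $P(k,\delta)$; (ii) if $q_4(G)<2\delta-\dfrac{9\left(k+\frac{\delta-1}{\delta}\right)}{\delta+1}$, then $G$ has property $P(k,\delta)$. -/

import Mathlib

namespace SimpleGraph

variable {V : Type*}

/-- The edge connectivity `κ'(G)`: the least number of edges of `G` whose deletion leaves a
graph that is not connected (with value `0` for the one-vertex graph). -/
noncomputable def edgeConnectivity (G : SimpleGraph V) : ℕ :=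
  sInf {m : ℕ | ∃ X : Finset (Sym2 V),
    (X : Set (Sym2 V)) ⊆ G.edgeSet ∧ X.card = m ∧ ¬ (G.deleteEdges (X : Set (Sym2 V))).Connected}

/-- The number `e(X, Y)` of edges with one end in `X` and the other in `Y`, for disjoint
`X` and `Y` (each such edge is counted once, as the pair consisting of its end in `X`
and its end in `Y`). -/
def numEdgesBetween (G : SimpleGraph V) [DecidableRel G.Adj] (X Y : Finset V) : ℕ :=
  (G.interedges X Y).card

/-- The class `𝒢_t`: there are `t + 1` non-empty, pairwise disjoint, proper vertex subsets
`W 0, …, W t` that do not cover the vertex set, each of whose edge boundaries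
has exactly `κ'(G)` edges. -/
def MemClassG (t : ℕ) (G : SimpleGraph V) [Fintype V] [DecidableEq V] [DecidableRel G.Adj] :
    Prop :=
  ∃ W : Fin (t + 1) → Finset V,
    (∀ i, (W i).Nonempty ∧ W i ≠ Finset.univ) ∧
    (∀ i j, i ≠ j → Disjoint (W i) (W j)) ∧
    (Finset.univ \ Finset.univ.biUnion W).Nonempty ∧
    ∀ i, G.edgeConnectivity = G.numEdgesBetween (W i) (Finset.univ \ W i)

/-- Property `P(k, d)`: `G` contains `k` edge-disjoint spanning trees `T i` and a further forest
`F`, edge-disjoint from all the `T i`, with more than `(d - 1) / d * (n - 1)` edges, such that if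
`F` is not a spanning tree then some component of `F` has at least `d` edges.
Subgraphs are taken with the full vertex set `V`, so `IsTree` means spanning tree. -/
def PropertyP (k d : ℕ) (G : SimpleGraph V) [Fintype V] : Prop :=
  ∃ (T : Fin k → SimpleGraph V) (F : SimpleGraph V),
    (∀ i, T i ≤ G ∧ (T i).IsTree) ∧
    (∀ i j, i ≠ j → Disjoint (T i).edgeSet (T j).edgeSet) ∧
    F ≤ G ∧ F.IsAcyclic ∧
    (∀ i, Disjoint F.edgeSet (T i).edgeSet) ∧
    ((d : ℝ) - 1) / d * ((Fintype.card V : ℝ) - 1) < (F.edgeSet.ncard : ℝ) ∧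
    (¬ F.IsTree → ∃ c : F.ConnectedComponent, d ≤ c.toSimpleGraph.edgeSet.ncard)

/-- The `i`-th largest eigenvalue, counted with multiplicity, of a real symmetric matrix of
order `n`, for `1 ≤ i ≤ n` (and `0` outside that range). -/
noncomputable def ithLargestEigenvalue [Fintype V] [DecidableEq V] {M : Matrix V V ℝ}
    (hM : M.IsHermitian) (i : ℕ) : ℝ :=
  if h : 1 ≤ i ∧ i ≤ Fintype.card V then hM.eigenvalues₀ ⟨i - 1, by omega⟩ else 0

section Matrices

variable (G : SimpleGraph V) [Fintype V] [DecidableEq V] [DecidableRel G.Adj]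

/-- The signless Laplacian matrix `Q(G) = D(G) + A(G)`. -/
def signlessLapMatrix : Matrix V V ℝ := G.degMatrix ℝ + G.adjMatrix ℝ

theorem isHermitian_adjMatrix_real : (G.adjMatrix ℝ).IsHermitian := by
  rw [Matrix.IsHermitian, Matrix.conjTranspose_eq_transpose_of_trivial]
  exact G.isSymm_adjMatrix

theorem isHermitian_signlessLapMatrix : G.signlessLapMatrix.IsHermitian := by
  rw [Matrix.IsHermitian, Matrix.conjTranspose_eq_transpose_of_trivial]
  exact (G.isSymm_degMatrix (R := ℝ)).add G.isSymm_adjMatrix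

/-- `λ_i(G)`, the `i`-th largest eigenvalue of the adjacency matrix of `G`. -/
noncomputable def adjEigenvalue (i : ℕ) : ℝ :=
  ithLargestEigenvalue G.isHermitian_adjMatrix_real i

/-- `q_i(G)`, the `i`-th largest eigenvalue of the signless Laplacian matrix of `G`. -/
noncomputable def signlessLapEigenvalue (i : ℕ) : ℝ :=
  ithLargestEigenvalue G.isHermitian_signlessLapMatrix i

end Matrices

end SimpleGraph

/-! Either spectral hypothesis excludes four disjoint sets of at least δ + 1 vertices, each with
boundary at most 4k + 3. On the span of their indicators the Laplacian form is at most 2(4k + 3)/(δ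
+ 1) times the squared norm. Since A = D - L and Q = 2D - L, such sets would force the fourth
eigenvalue too high (`le_adjEigenvalue`, `le_signlessLapEigenvalue`).

Without such sets, G even has k + 1 edge-disjoint spanning trees. Otherwise Nash-Williams–Tutte
gives a partition into q + 1 classes with fewer than (k + 1)q crossing edges. A non-empty set with
boundary below δ has more than δ vertices, so at most three classes have boundary below 3k + 3, and
counting gives 3κ' ≤ 4k + 2. The set R of vertices outside all W i has boundary at most 3κ'. It
cannot be a fourth large set, so it has at most δ vertices. Hence its boundary is at least δ, and κ'
≥ k + 1. This forces exactly three classes, each containing exactly one W i, with R inside a single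
class. Then R is a class minus one W i, and its boundary is at most 4k + 2 - κ' < δ, a contradiction
(`mul_pred_le_card_crossGraph`). -/

namespace SimpleGraph

/-! ### Forest packings and the Nash-Williams–Tutte theorem -/

section ForestPacking

variable {V : Type*} {ι : Type*} {G : SimpleGraph V}

theorem Reachable.of_forall_adj {H H' : SimpleGraph V}
    (h : ∀ a b, H.Adj a b → H'.Reachable a b) {x y : V} (hxy : H.Reachable x y) :
    H'.Reachable x y := by
  obtain ⟨p⟩ := hxy
  induction p with
  | nil => exact .rfl
  | cons hadj _ ih => exact (h _ _ hadj).trans ih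

theorem IsAcyclic.not_reachable_deleteEdges_of_mem_path {F : SimpleGraph V} (hF : F.IsAcyclic)
    {a b c d : V} {p : F.Walk a b} (hp : p.IsPath) (hcd : s(c, d) ∈ p.edges) :
    ¬ (F.deleteEdges {s(c, d)}).Reachable a b := by
  classical
  rw [reachable_deleteEdges_iff_exists_walk]
  rintro ⟨q, hq⟩
  have h := (hF.subsingleton_path a b).elim ⟨p, hp⟩ q.toPath
  have h' : p = q.toPath.1 := congrArg Subtype.val h
  exact hq (q.edges_toPath_subset_edges (h' ▸ hcd))

/-- The number of vertices is at most the number of edges plus the number of components. -/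
theorem card_le_card_edgeSet_add_card_connectedComponent [Finite V] (H : SimpleGraph V) :
    Nat.card V ≤ H.edgeSet.ncard + Nat.card H.ConnectedComponent := by
  classical
  cases isEmpty_or_nonempty V with
  | inl h => simp
  | inr hne =>
    obtain ⟨v₀⟩ := hne
    let r : H.ConnectedComponent → V := fun c => c.out
    have hr : ∀ v, H.Reachable (r (H.connectedComponentMk v)) v := fun v =>
      ConnectedComponent.exact (Quot.out_eq _)
    let S : Set H.ConnectedComponent := {H.connectedComponentMk v₀}ᶜ
    let E : Set (Sym2 V) := (fun c => s(v₀, r c)) '' S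
    have hE : E.ncard + 1 ≤ Nat.card H.ConnectedComponent := by
      have h1 : E.ncard ≤ S.ncard := Set.ncard_image_le (Set.toFinite _)
      have h2 : S.ncard + 1 = Nat.card H.ConnectedComponent := by
        have : _ + S.ncard = _ := Set.ncard_add_ncard_compl {H.connectedComponentMk v₀}
        rw [Set.ncard_singleton] at this
        omega
      omega
    -- Joining v₀ to a representative of every other component makes the graph connected at the cost
    -- of one edge fewer than there are components.
    let K : SimpleGraph V := H ⊔ fromEdgeSet E
    have hto : ∀ v, K.Reachable v₀ v := by
      intro v
      by_cases hv : H.connectedComponentMk v = H.connectedComponentMk v₀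
      · exact (ConnectedComponent.exact hv).symm.mono le_sup_left
      · refine Reachable.trans ?_ ((hr v).mono le_sup_left)
        refine Adj.reachable (Or.inr ?_)
        rw [fromEdgeSet_adj]
        refine ⟨⟨_, hv, rfl⟩, fun h => hv ?_⟩
        have := hr v
        rw [← h] at this
        exact (ConnectedComponent.sound this).symm
    have hK : K.Connected :=
      { preconnected := fun a b => (hto a).symm.trans (hto b)
        nonempty := ⟨v₀⟩ }
    have h1 := hK.card_vert_le_card_edgeSet_add_one
    have h2 : Nat.card K.edgeSet ≤ H.edgeSet.ncard + E.ncard := by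
      rw [Nat.card_coe_set_eq, edgeSet_sup]
      refine (Set.ncard_union_le _ _).trans (Nat.add_le_add_left ?_ _)
      exact Set.ncard_le_ncard (by simp [edgeSet_fromEdgeSet]) (Set.toFinite _)
    omega

theorem IsAcyclic.exists_isTree_ge [Nonempty V] {F : SimpleGraph V} (hF : F.IsAcyclic) :
    ∃ T, F ≤ T ∧ T.IsTree := by
  obtain ⟨T, h, -, hT⟩ := (connected_top (V := V)).exists_isTree_le_of_le_of_isAcyclic le_top hF
  exact ⟨T, h, hT⟩

theorem IsTree.ncard_edgeSet_add_one [Finite V] {T : SimpleGraph V} (hT : T.IsTree) :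
    T.edgeSet.ncard + 1 = Nat.card V := by
  rw [← Nat.card_coe_set_eq]
  exact (isTree_iff_connected_and_card.mp hT).2

theorem IsAcyclic.ncard_edgeSet_add_one_le [Finite V] [Nonempty V] {F : SimpleGraph V}
    (hF : F.IsAcyclic) : F.edgeSet.ncard + 1 ≤ Nat.card V := by
  obtain ⟨T, hle, hT⟩ := hF.exists_isTree_ge
  rw [← hT.ncard_edgeSet_add_one]
  exact Nat.add_le_add_right (Set.ncard_le_ncard (edgeSet_mono hle) (Set.toFinite _)) _

theorem IsAcyclic.isTree_of_card_le [Finite V] [Nonempty V] {F : SimpleGraph V}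
    (hF : F.IsAcyclic) (h : Nat.card V ≤ F.edgeSet.ncard + 1) : F.IsTree := by
  obtain ⟨T, hle, hT⟩ := hF.exists_isTree_ge
  have hT' := hT.ncard_edgeSet_add_one
  have : F.edgeSet = T.edgeSet :=
    Set.eq_of_subset_of_ncard_le (edgeSet_mono hle) (by omega) (Set.toFinite _)
  rwa [edgeSet_injective this]

/-- A family of pairwise edge-disjoint forests in `G`. -/
structure IsForestPacking (G : SimpleGraph V) (F : ι → SimpleGraph V) : Prop where
  le : ∀ i, F i ≤ G
  isAcyclic : ∀ i, (F i).IsAcyclic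
  disjoint : ∀ i j, i ≠ j → ∀ a b, (F i).Adj a b → ¬ (F j).Adj a b

/-- A forest packing with the largest possible total number of edges. -/
structure IsMaxForestPacking [Fintype ι] (G : SimpleGraph V) (F : ι → SimpleGraph V) : Prop
    extends IsForestPacking G F where
  max : ∀ F' : ι → SimpleGraph V, IsForestPacking G F' →
    ∑ i, (F' i).edgeSet.ncard ≤ ∑ i, (F i).edgeSet.ncard

theorem exists_isMaxForestPacking [Finite V] [Fintype ι] (G : SimpleGraph V) :
    ∃ F : ι → SimpleGraph V, IsMaxForestPacking G F := by
  have hne : {F : ι → SimpleGraph V | IsForestPacking G F}.Nonempty :=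
    ⟨fun _ => ⊥, fun _ => bot_le, fun _ => isAcyclic_bot, fun _ _ _ _ _ h => h.elim⟩
  obtain ⟨F, hF, hmax⟩ := Set.exists_max_image _
    (fun F : ι → SimpleGraph V => ∑ i, (F i).edgeSet.ncard) (Set.toFinite _) hne
  exact ⟨F, hF, hmax⟩

/-- `ab` is an edge of `G` in none of the `F i`. -/
def Uncovered (G : SimpleGraph V) (F : ι → SimpleGraph V) (a b : V) : Prop :=
  G.Adj a b ∧ ∀ i, ¬ (F i).Adj a b

theorem Uncovered.symm {F : ι → SimpleGraph V} {a b : V} (h : Uncovered G F a b) :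
    Uncovered G F b a :=
  ⟨h.1.symm, fun i hi => h.2 i hi.symm⟩

theorem IsForestPacking.update [DecidableEq ι] {F : ι → SimpleGraph V} (hF : IsForestPacking G F)
    {i : ι} {a b : V} (hab : Uncovered G F a b) {H : SimpleGraph V} (hH : H ≤ F i)
    (hn : ¬ H.Reachable a b) :
    IsForestPacking G (Function.update F i (H ⊔ edge a b)) := by
  have key : ∀ x y, (H ⊔ edge a b).Adj x y → (F i).Adj x y ∨ Uncovered G F x y := by
    rintro x y (h | h)
    · exact Or.inl (hH h)
    · rw [edge_adj] at h
      obtain ⟨⟨rfl, rfl⟩ | ⟨rfl, rfl⟩, -⟩ := h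
      exacts [Or.inr hab, Or.inr hab.symm]
  refine ⟨fun j => ?_, fun j => ?_, fun j l hjl x y => ?_⟩
  · obtain rfl | hj := eq_or_ne j i
    · rw [Function.update_self]
      intro x y h
      exact (key x y h).elim (fun h => hF.le _ h) (fun h => h.1)
    · rw [Function.update_of_ne hj]
      exact hF.le j
  · obtain rfl | hj := eq_or_ne j i
    · rw [Function.update_self]
      exact IsAcyclic.sup_edge_of_not_reachable hn ((hF.isAcyclic _).anti hH)
    · rw [Function.update_of_ne hj]
      exact hF.isAcyclic j
  · obtain rfl | hj := eq_or_ne j i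
    · rw [Function.update_self, Function.update_of_ne hjl.symm]
      intro h
      exact (key x y h).elim (fun h => hF.disjoint _ _ hjl _ _ h) (fun h => h.2 l)
    · rw [Function.update_of_ne hj]
      obtain rfl | hl := eq_or_ne l i
      · rw [Function.update_self]
        intro h h'
        exact (key x y h').elim (fun h' => hF.disjoint _ _ hj _ _ h h') (fun h' => h'.2 j h)
      · rw [Function.update_of_ne hl]
        exact hF.disjoint _ _ hjl x y

theorem ncard_edgeSet_sup_edge [Finite V] {H : SimpleGraph V} {a b : V} (hne : a ≠ b)
    (h : ¬ H.Adj a b) : (H ⊔ edge a b).edgeSet.ncard = H.edgeSet.ncard + 1 := by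
  rw [edgeSet_sup, edgeSet_edge_of_ne hne, Set.union_singleton,
    Set.ncard_insert_of_notMem (by simpa using h) (Set.toFinite _)]

theorem sum_ncard_update [Fintype ι] [DecidableEq ι] (F : ι → SimpleGraph V) (i : ι)
    (H : SimpleGraph V) :
    ∑ j, (Function.update F i H j).edgeSet.ncard + (F i).edgeSet.ncard
      = ∑ j, (F j).edgeSet.ncard + H.edgeSet.ncard := by
  rw [← Finset.add_sum_erase _ _ (Finset.mem_univ i),
    ← Finset.add_sum_erase (a := i) _ (fun j => (F j).edgeSet.ncard) (Finset.mem_univ i),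
    Function.update_self]
  have : ∑ j ∈ Finset.univ.erase i, (Function.update F i H j).edgeSet.ncard
      = ∑ j ∈ Finset.univ.erase i, (F j).edgeSet.ncard :=
    Finset.sum_congr rfl fun j hj => by rw [Function.update_of_ne (Finset.ne_of_mem_erase hj)]
  rw [this]
  ring

/-- Otherwise adding ab to F i would give a larger packing. -/
theorem IsMaxForestPacking.reachable [Finite V] [Fintype ι] {F : ι → SimpleGraph V}
    (hF : IsMaxForestPacking G F) {a b : V} (hab : Uncovered G F a b) (i : ι) :
    (F i).Reachable a b := by
  classical
  by_contra hn
  have h1 := hF.max _ (hF.toIsForestPacking.update hab le_rfl hn)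
  have h2 := sum_ncard_update F i (F i ⊔ edge a b)
  rw [ncard_edgeSet_sup_edge hab.1.ne (hab.2 i)] at h2
  omega

/-- `F'` arises from `F` by exchanging an edge of a cycle of `F i + ab` for an uncovered edge
`ab`. -/
def IsExchange [DecidableEq ι] (G : SimpleGraph V) (F F' : ι → SimpleGraph V) : Prop :=
  ∃ i a b c d, Uncovered G F a b ∧ (F i).Adj c d ∧
    ¬ ((F i).deleteEdges {s(c, d)}).Reachable a b ∧
    F' = Function.update F i ((F i).deleteEdges {s(c, d)} ⊔ edge a b)

theorem IsMaxForestPacking.of_isExchange [Finite V] [Fintype ι] [DecidableEq ι]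
    {F F' : ι → SimpleGraph V} (hF : IsMaxForestPacking G F) (h : IsExchange G F F') :
    IsMaxForestPacking G F' := by
  obtain ⟨i, a, b, c, d, hab, hcd, hn, rfl⟩ := h
  refine ⟨hF.toIsForestPacking.update hab (deleteEdges_le _) hn, fun F'' hF'' => ?_⟩
  have h1 := hF.max F'' hF''
  have h2 := sum_ncard_update F i ((F i).deleteEdges {s(c, d)} ⊔ edge a b)
  rw [ncard_edgeSet_sup_edge hab.1.ne (fun h => hab.2 i (deleteEdges_le _ h)),
    edgeSet_deleteEdges] at h2
  have h3 := Set.ncard_sdiff_singleton_add_one (s := (F i).edgeSet) (a := s(c, d)) hcd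
    (Set.toFinite _)
  omega

/-- The graph of all edges that are uncovered in some packing obtained from `F₀` by exchanges. -/
def exchangeGraph [DecidableEq ι] (G : SimpleGraph V) (F₀ : ι → SimpleGraph V) :
    SimpleGraph V where
  Adj x y := ∃ F, Relation.ReflTransGen (IsExchange G) F₀ F ∧ Uncovered G F x y
  symm := ⟨fun _ _ ⟨F, h, h'⟩ => ⟨F, h, h'.symm⟩⟩
  loopless := ⟨fun _ ⟨_, _, h⟩ => h.1.ne rfl⟩

theorem IsMaxForestPacking.of_reflTransGen [Finite V] [Fintype ι] [DecidableEq ι]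
    {F F' : ι → SimpleGraph V} (hF : IsMaxForestPacking G F)
    (h : Relation.ReflTransGen (IsExchange G) F F') : IsMaxForestPacking G F' := by
  induction h with
  | refl => exact hF
  | tail _ h ih => exact ih.of_isExchange h

/-- Any edge of the path from a to b in F i can be exchanged for ab and is then uncovered, so the
whole path lies in the exchange graph. -/
theorem Uncovered.reachable_inf_exchangeGraph [Finite V] [Fintype ι] [DecidableEq ι]
    {F₀ F : ι → SimpleGraph V} (hF₀ : IsMaxForestPacking G F₀)
    (h : Relation.ReflTransGen (IsExchange G) F₀ F) {a b : V} (hab : Uncovered G F a b) (i : ι) :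
    (F i ⊓ exchangeGraph G F₀).Reachable a b := by
  classical
  have hF := hF₀.of_reflTransGen h
  obtain ⟨q⟩ := hF.reachable hab i
  obtain ⟨p, hp⟩ := q.toPath
  refine ⟨p.transfer _ fun e he => ?_⟩
  induction e with
  | h c d =>
    have hcd : (F i).Adj c d := p.adj_of_mem_edges he
    refine ⟨hcd, _, h.tail ⟨i, a, b, c, d, hab, hcd,
      (hF.isAcyclic i).not_reachable_deleteEdges_of_mem_path hp he, rfl⟩, hF.le i hcd,
      fun j hj => ?_⟩
    obtain rfl | hji := eq_or_ne j i
    · rw [Function.update_self] at hj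
      rcases hj with hj | hj
      · simp at hj
      · rw [edge_adj] at hj
        obtain ⟨⟨rfl, rfl⟩ | ⟨rfl, rfl⟩, -⟩ := hj
        exacts [hab.2 _ hcd, hab.2 _ hcd.symm]
    · rw [Function.update_of_ne hji] at hj
      exact hF.disjoint _ _ hji _ _ hj hcd

/-- Exchanges are undone one at a time: the only new edge ab was uncovered just before, so its ends
were already joined inside the exchange graph by the previous forest. -/
theorem IsMaxForestPacking.reachable_inf_of_reflTransGen [Finite V] [Fintype ι] [DecidableEq ι]
    {F₀ F : ι → SimpleGraph V} (hF₀ : IsMaxForestPacking G F₀)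
    (h : Relation.ReflTransGen (IsExchange G) F₀ F) (i : ι) {x y : V}
    (hxy : (F i ⊓ exchangeGraph G F₀).Reachable x y) :
    (F₀ i ⊓ exchangeGraph G F₀).Reachable x y := by
  induction h with
  | refl => exact hxy
  | @tail F F' h hstep ih =>
    refine ih (Reachable.of_forall_adj (fun u v huv => ?_) hxy)
    by_cases huv' : (F i).Adj u v
    · exact Adj.reachable ⟨huv', huv.2⟩
    · obtain ⟨j, a, b, c, d, hab, -, -, rfl⟩ := hstep
      have h1 := huv.1
      obtain rfl | hij := eq_or_ne i j
      · rw [Function.update_self] at h1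
        rcases h1 with h1 | h1
        · exact (huv' (deleteEdges_le _ h1)).elim
        · rw [edge_adj] at h1
          obtain ⟨⟨rfl, rfl⟩ | ⟨rfl, rfl⟩, -⟩ := h1
          exacts [hab.reachable_inf_exchangeGraph hF₀ h i,
            (hab.reachable_inf_exchangeGraph hF₀ h i).symm]
      · rw [Function.update_of_ne hij] at h1
        exact (huv' h1).elim

theorem IsMaxForestPacking.reachable_inf_of_adj [Finite V] [Fintype ι] [DecidableEq ι]
    {F₀ : ι → SimpleGraph V} (hF₀ : IsMaxForestPacking G F₀) (i : ι) {x y : V}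
    (hxy : (exchangeGraph G F₀).Adj x y) : (F₀ i ⊓ exchangeGraph G F₀).Reachable x y := by
  obtain ⟨F, h, hF⟩ := hxy
  exact hF₀.reachable_inf_of_reflTransGen h i (hF.reachable_inf_exchangeGraph hF₀ h i)

/-- The edges of `G` joining different classes of the partition into the fibres of `f`. -/
def crossGraph {α : Type*} (G : SimpleGraph V) (f : V → α) : SimpleGraph V where
  Adj x y := G.Adj x y ∧ f x ≠ f y
  symm := ⟨fun _ _ h => ⟨h.1.symm, h.2.symm⟩⟩
  loopless := ⟨fun _ h => h.2 rfl⟩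

/-- **Nash-Williams–Tutte theorem**: if for every partition of the vertex set into `s` classes
at least `K * (s - 1)` edges join different classes, then there are `K` pairwise edge-disjoint
spanning trees. -/
theorem exists_edge_disjoint_spanning_trees [Finite V] [Nonempty V] (G : SimpleGraph V) (K : ℕ)
    (h : ∀ (s : ℕ) (f : V → Fin s), Function.Surjective f →
      K * (s - 1) ≤ (crossGraph G f).edgeSet.ncard) :
    ∃ T : Fin K → SimpleGraph V, (∀ i, T i ≤ G ∧ (T i).IsTree) ∧
      ∀ i j, i ≠ j → Disjoint (T i).edgeSet (T j).edgeSet := by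
  classical
  obtain ⟨F, hF⟩ := exists_isMaxForestPacking (ι := Fin K) G
  refine ⟨F, ?_, fun i j hij => Set.disjoint_left.mpr fun e => ?_⟩
  swap
  · induction e with
    | h a b => exact hF.disjoint i j hij a b
  let G₀ := exchangeGraph G F
  have : Fintype G₀.ConnectedComponent := Fintype.ofFinite _
  let s := Fintype.card G₀.ConnectedComponent
  have hs : 0 < s := Fintype.card_pos
  let f : V → Fin s := fun v => Fintype.equivFin _ (G₀.connectedComponentMk v)
  have hf : Function.Surjective f := (Equiv.surjective _).comp Quot.mk_surjective
  have h1 := h s f hf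
  have h2 : (crossGraph G f).edgeSet.ncard ≤ ∑ i, ((F i).edgeSet \ G₀.edgeSet).ncard := by
    have hsub : (crossGraph G f).edgeSet ⊆ ⋃ i, ((F i).edgeSet \ G₀.edgeSet) := by
      intro e he
      induction e with
      | h a b =>
        obtain ⟨hG, hne⟩ : G.Adj a b ∧ f a ≠ f b := he
        have hn : ¬ G₀.Adj a b := fun h0 =>
          hne (congrArg (Fintype.equivFin _) (ConnectedComponent.sound h0.reachable))
        by_contra hc
        -- An edge in no F i lies in G₀ after zero exchanges.
        refine hn ⟨F, .refl, hG, fun i hi => hc (Set.mem_iUnion.mpr ⟨i, hi, hn⟩)⟩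
    refine (Set.ncard_le_ncard hsub (Set.toFinite _)).trans ?_
    simpa using Finset.set_ncard_biUnion_le Finset.univ fun i => (F i).edgeSet \ G₀.edgeSet
  have h3 : ∀ i, Nat.card V ≤ ((F i).edgeSet ∩ G₀.edgeSet).ncard + s := by
    intro i
    have hcc := card_le_card_edgeSet_add_card_connectedComponent (F i ⊓ G₀)
    rw [edgeSet_inf] at hcc
    refine hcc.trans (Nat.add_le_add_left ?_ _)
    -- F i ⊓ G₀ already connects each component of G₀, so it has no more components than G₀.
    rw [show s = _ from (Nat.card_eq_fintype_card (α := G₀.ConnectedComponent)).symm]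
    refine Nat.card_le_card_of_injective
      (ConnectedComponent.map (Hom.ofLE (inf_le_right : F i ⊓ G₀ ≤ G₀))) ?_
    refine ConnectedComponent.ind₂ fun u v huv => ?_
    refine ConnectedComponent.sound ?_
    exact Reachable.of_forall_adj (fun a b hab => hF.reachable_inf_of_adj i hab)
      (ConnectedComponent.exact huv)
  have h4 : ∀ i, (F i).edgeSet.ncard
      = ((F i).edgeSet ∩ G₀.edgeSet).ncard + ((F i).edgeSet \ G₀.edgeSet).ncard := fun i =>
    (Set.ncard_inter_add_ncard_sdiff_eq_ncard _ _ (Set.toFinite _)).symm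
  -- With n vertices, each forest has at least n - s edges inside G₀, and together they have at
  -- least K(s - 1) outside. The total K(n - 1) is the most that K forests can have, so each is a
  -- tree.
  have h5 : K * Nat.card V ≤ ∑ i, (F i).edgeSet.ncard + K := by
    have h6 : K * Nat.card V ≤ ∑ i, ((F i).edgeSet ∩ G₀.edgeSet).ncard + K * s := by
      have := Finset.sum_le_sum fun i (_ : i ∈ Finset.univ) => h3 i
      simpa [Finset.sum_add_distrib] using this
    have h7 : K * s = K * (s - 1) + K := by
      obtain ⟨t, ht⟩ := Nat.exists_eq_add_of_lt hs
      rw [ht]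
      simp
      ring
    simp_rw [h4, Finset.sum_add_distrib]
    omega
  have h8 : ∀ i, (F i).edgeSet.ncard + 1 ≤ Nat.card V := fun i =>
    (hF.isAcyclic i).ncard_edgeSet_add_one_le
  have h9 : ∑ i, ((F i).edgeSet.ncard + 1) = ∑ _i : Fin K, Nat.card V := by
    refine le_antisymm (Finset.sum_le_sum fun i _ => h8 i) ?_
    simpa [Finset.sum_add_distrib] using h5
  have h10 := (Finset.sum_eq_sum_iff_of_le fun i _ => h8 i).mp h9
  exact fun i => ⟨hF.le i, (hF.isAcyclic i).isTree_of_card_le (h10 i (Finset.mem_univ i)).ge⟩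

end ForestPacking

/-! ### Combinations of indicators of disjoint sets -/

section IndicatorComb

variable {V : Type*} [DecidableEq V]

/-- The linear combination of the indicator functions of the sets `S i`. -/
def indicatorComb {m : ℕ} (S : Fin m → Finset V) : (Fin m → ℝ) →ₗ[ℝ] (V → ℝ) where
  toFun y v := ∑ i, if v ∈ S i then y i else 0
  map_add' y z := by
    ext v
    simp only [Pi.add_apply, ← Finset.sum_add_distrib]
    exact Finset.sum_congr rfl fun i _ => by split_ifs <;> simp
  map_smul' c y := by
    ext v
    simp [Finset.mul_sum]

theorem forall_mem_iff_or_forall_notMem {m : ℕ} {S : Fin m → Finset V}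
    (hS : ∀ i j, i ≠ j → Disjoint (S i) (S j)) (v : V) :
    (∃ i, ∀ j, v ∈ S j ↔ j = i) ∨ ∀ j, v ∉ S j := by
  by_cases h : ∃ i, v ∈ S i
  · obtain ⟨i, hi⟩ := h
    refine Or.inl ⟨i, fun j => ⟨fun hj => ?_, fun h => h ▸ hi⟩⟩
    by_contra hne
    exact Finset.disjoint_left.mp (hS j i hne) hj hi
  · exact Or.inr (not_exists.mp h)

/-- By (a - b)² ≤ 2a² + 2b², an edge between two of the sets is charged separately to each, which
removes all cross terms. -/
theorem sub_sq_indicatorComb_le {m : ℕ} {S : Fin m → Finset V}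
    (hS : ∀ i j, i ≠ j → Disjoint (S i) (S j)) (y : Fin m → ℝ) (u v : V) :
    (indicatorComb S y u - indicatorComb S y v) ^ 2
      ≤ ∑ i, 2 * y i ^ 2 *
        ((if u ∈ S i ∧ v ∉ S i then 1 else 0) + if v ∈ S i ∧ u ∉ S i then 1 else 0) := by
  simp only [indicatorComb, LinearMap.coe_mk, AddHom.coe_mk, mul_add, Finset.sum_add_distrib]
  rcases forall_mem_iff_or_forall_notMem hS u with ⟨i, hi⟩ | hu <;>
    rcases forall_mem_iff_or_forall_notMem hS v with ⟨j, hj⟩ | hv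
  · obtain rfl | hij := eq_or_ne i j
    · simp [hi, hj]
    · have h1 : ∀ l, (l = i ∧ ¬ l = j) ↔ l = i := fun l => by grind
      have h2 : ∀ l, (l = j ∧ ¬ l = i) ↔ l = j := fun l => by grind
      simp only [hi, hj, h1, h2]
      simp
      nlinarith [sq_nonneg (y i + y j)]
  · simp [hi, hv]
    nlinarith [sq_nonneg (y i)]
  · simp [hj, hu]
    nlinarith [sq_nonneg (y j)]
  · simp [hu, hv]

theorem indicatorComb_injective {m : ℕ} {S : Fin m → Finset V} (hne : ∀ i, (S i).Nonempty)
    (hS : ∀ i j, i ≠ j → Disjoint (S i) (S j)) : Function.Injective (indicatorComb S) := by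
  rw [injective_iff_map_eq_zero]
  intro y hy
  ext i
  obtain ⟨v, hv⟩ := hne i
  rcases forall_mem_iff_or_forall_notMem hS v with ⟨j, hj⟩ | h
  · obtain rfl := (hj i).mp hv
    simpa [indicatorComb, hj] using congrFun hy v
  · exact (h i hv).elim

end IndicatorComb

/-! ### Eigenvalue bounds from disjoint sets with small boundary -/

section Spectral

open Matrix

variable {V : Type*} [Fintype V] [DecidableEq V]

/-- The easy half of the Courant–Fischer theorem: if the quadratic form of `M` is at least
`c * ‖x‖ ^ 2` on an `m`-dimensional subspace, then the `m`-th largest eigenvalue is at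
least `c`. -/
theorem le_ithLargestEigenvalue {M : Matrix V V ℝ} (hM : M.IsHermitian) {m : ℕ} (hm : 1 ≤ m)
    (φ : (Fin m → ℝ) →ₗ[ℝ] (V → ℝ)) (hφ : Function.Injective φ) (c : ℝ)
    (h : ∀ y, c * (φ y ⬝ᵥ φ y) ≤ φ y ⬝ᵥ M *ᵥ φ y) : c ≤ ithLargestEigenvalue hM m := by
  have hcard : m ≤ Fintype.card V := by
    simpa using LinearMap.finrank_le_finrank_of_injective hφ
  rw [ithLargestEigenvalue, dif_pos ⟨hm, hcard⟩]
  set μ := hM.eigenvalues₀ ⟨m - 1, by omega⟩ with hμ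
  -- The enumeration through which `eigenvalues` is defined from `eigenvalues₀`; the first m - 1
  -- indices carry the largest eigenvalues.
  let e : Fin (Fintype.card V) ≃ V := Fintype.equivOfCardEq (Fintype.card_fin _)
  let b := hM.eigenvectorBasis
  let ψ : (Fin m → ℝ) →ₗ[ℝ] (Fin (m - 1) → ℝ) :=
    LinearMap.pi fun j =>
      (dotProductBilin ℝ ℝ (b (e ⟨j, by omega⟩) : V → ℝ)).comp φ
  -- Some non-zero vector of the m-dimensional image is orthogonal to the top m - 1 eigenvectors.
  have hker : LinearMap.ker ψ ≠ ⊥ := LinearMap.ker_ne_bot_of_finrank_lt (by simp; omega)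
  obtain ⟨y, hy, hy0⟩ := (Submodule.ne_bot_iff _).mp hker
  set x := φ y with hx
  have hx0 : x ≠ 0 := fun h0 => hy0 (hφ (by rw [← hx, h0, map_zero]))
  let a : V → ℝ := fun v => (b v : V → ℝ) ⬝ᵥ x
  have hinner : ∀ (v : V) (z : V → ℝ),
      inner ℝ (b v) (WithLp.toLp 2 z) = (b v : V → ℝ) ⬝ᵥ z := by
    intro v z
    rw [EuclideanSpace.inner_eq_star_dotProduct]
    simp [dotProduct_comm]
  have hexp : ∀ z : V → ℝ, x ⬝ᵥ z = ∑ v, a v * ((b v : V → ℝ) ⬝ᵥ z) := by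
    intro z
    have h1 := b.sum_inner_mul_inner (WithLp.toLp 2 x) (WithLp.toLp 2 z)
    simp_rw [real_inner_comm _ (WithLp.toLp 2 x), hinner] at h1
    rw [h1, EuclideanSpace.inner_eq_star_dotProduct]
    simp [dotProduct_comm]
  have hMx : ∀ v, (b v : V → ℝ) ⬝ᵥ M *ᵥ x = hM.eigenvalues v * a v := by
    intro v
    have hT : Mᵀ = M := by
      have := hM.eq
      rwa [conjTranspose_eq_transpose_of_trivial] at this
    rw [dotProduct_mulVec, ← mulVec_transpose, hT, hM.mulVec_eigenvectorBasis, smul_dotProduct]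
    rfl
  have ha : ∀ v, hM.eigenvalues v * (a v * a v) ≤ μ * (a v * a v) := by
    intro v
    by_cases hv : (e.symm v : ℕ) < m - 1
    · have h0 : a v = 0 := by
        have := congrFun (LinearMap.mem_ker.mp hy) ⟨e.symm v, hv⟩
        simpa [ψ, a, x] using this
      simp [h0]
    · refine mul_le_mul_of_nonneg_right ?_ (mul_self_nonneg _)
      exact hM.eigenvalues₀_antitone (Fin.mk_le_of_le_val (by simpa using hv))
  have h1 : x ⬝ᵥ M *ᵥ x ≤ μ * (x ⬝ᵥ x) := by
    rw [hexp, hexp x, Finset.mul_sum]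
    refine Finset.sum_le_sum fun v _ => ?_
    rw [hMx]
    linarith [ha v]
  have h2 := (h y).trans h1
  have h3 : 0 < x ⬝ᵥ x := by
    refine lt_of_le_of_ne (Finset.sum_nonneg fun i _ => mul_self_nonneg _) fun h0 => hx0 ?_
    exact dotProduct_self_eq_zero.mp h0.symm
  exact le_of_mul_le_mul_right h2 h3

/-- The number of edges leaving `S`. -/
def cut (G : SimpleGraph V) [DecidableRel G.Adj] (S : Finset V) : ℕ :=
  G.numEdgesBetween S (Finset.univ \ S)

theorem cut_eq_sum (G : SimpleGraph V) [DecidableRel G.Adj] (S : Finset V) :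
    (G.cut S : ℝ) = ∑ u, ∑ v, if G.Adj u v then (if u ∈ S ∧ v ∉ S then 1 else 0) else 0 := by
  rw [cut, numEdgesBetween, interedges_def, Finset.card_filter, Finset.sum_product,
    ← Finset.sum_subset (Finset.subset_univ S)]
  · push_cast
    refine Finset.sum_congr rfl fun u hu => ?_
    rw [← Finset.sum_subset (Finset.subset_univ (Finset.univ \ S))]
    · refine Finset.sum_congr rfl fun v hv => ?_
      have : v ∉ S := by simpa using hv
      simp [hu, this]
    · intro v _ hv
      have : v ∈ S := by simpa using hv
      simp [this]
  · intro u _ hu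
    simp [hu]

theorem sum_indicatorComb_sq {m : ℕ} {S : Fin m → Finset V}
    (hS : ∀ i j, i ≠ j → Disjoint (S i) (S j)) (y : Fin m → ℝ) :
    indicatorComb S y ⬝ᵥ indicatorComb S y = ∑ i, (S i).card * y i ^ 2 := by
  have h : ∀ v, indicatorComb S y v * indicatorComb S y v
      = ∑ i, if v ∈ S i then y i ^ 2 else 0 := by
    intro v
    simp only [indicatorComb, LinearMap.coe_mk, AddHom.coe_mk]
    rcases forall_mem_iff_or_forall_notMem hS v with ⟨i, hi⟩ | hv
    · simp [hi, sq]
    · simp [hv]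
  simp_rw [dotProduct, h]
  rw [Finset.sum_comm]
  simp

theorem lapMatrix_indicatorComb_le (G : SimpleGraph V) [DecidableRel G.Adj] {m : ℕ}
    {S : Fin m → Finset V} (hS : ∀ i j, i ≠ j → Disjoint (S i) (S j)) (y : Fin m → ℝ) :
    indicatorComb S y ⬝ᵥ G.lapMatrix ℝ *ᵥ indicatorComb S y
      ≤ ∑ i, 2 * y i ^ 2 * (G.cut (S i)) := by
  have h := G.lapMatrix_toLinearMap₂' ℝ (indicatorComb S y)
  rw [Matrix.toLinearMap₂'_apply'] at h
  rw [h, div_le_iff₀ (by norm_num)]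
  have hcut : ∀ i, (G.cut (S i) : ℝ) * 2 = ∑ u, ∑ v, if G.Adj u v then
      ((if u ∈ S i ∧ v ∉ S i then 1 else 0) + if v ∈ S i ∧ u ∉ S i then 1 else 0) else (0 : ℝ) := by
    intro i
    rw [mul_two]
    nth_rewrite 2 [cut_eq_sum]
    rw [Finset.sum_comm, cut_eq_sum, ← Finset.sum_add_distrib]
    refine Finset.sum_congr rfl fun u _ => ?_
    rw [← Finset.sum_add_distrib]
    refine Finset.sum_congr rfl fun v _ => ?_
    simp only [G.adj_comm v u]
    split_ifs <;> simp
  calc _ ≤ ∑ u, ∑ v, ∑ i, 2 * y i ^ 2 * (if G.Adj u v then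
        ((if u ∈ S i ∧ v ∉ S i then 1 else 0) + if v ∈ S i ∧ u ∉ S i then 1 else 0) else 0) := by
        refine Finset.sum_le_sum fun u _ => Finset.sum_le_sum fun v _ => ?_
        by_cases huv : G.Adj u v
        · simp only [huv, if_true]
          exact sub_sq_indicatorComb_le hS y u v
        · simp [huv]
    _ = _ := by
        simp_rw [Finset.sum_mul, mul_assoc _ _ (2 : ℝ), hcut, Finset.mul_sum]
        rw [Finset.sum_comm]
        refine (Finset.sum_congr rfl fun v _ => Finset.sum_comm).trans ?_
        rw [Finset.sum_comm]
        refine Finset.sum_congr rfl fun i _ => Finset.sum_comm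

theorem mul_le_degMatrix (G : SimpleGraph V) [DecidableRel G.Adj] (x : V → ℝ) :
    (G.minDegree : ℝ) * (x ⬝ᵥ x) ≤ x ⬝ᵥ G.degMatrix ℝ *ᵥ x := by
  rw [dotProduct_mulVec_degMatrix, dotProduct, Finset.mul_sum]
  refine Finset.sum_le_sum fun v _ => ?_
  rw [mul_assoc]
  refine mul_le_mul_of_nonneg_right ?_ (mul_self_nonneg _)
  exact_mod_cast G.minDegree_le_degree v

theorem lapMatrix_indicatorComb_le_of_cut_le (G : SimpleGraph V) [DecidableRel G.Adj] {m : ℕ}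
    {S : Fin m → Finset V} (hS : ∀ i j, i ≠ j → Disjoint (S i) (S j)) {N : ℕ}
    (hN : ∀ i, N + 1 ≤ (S i).card) {B : ℕ} (hB : ∀ i, G.cut (S i) ≤ B) (y : Fin m → ℝ) :
    indicatorComb S y ⬝ᵥ G.lapMatrix ℝ *ᵥ indicatorComb S y
      ≤ 2 * B / (N + 1) * (indicatorComb S y ⬝ᵥ indicatorComb S y) := by
  refine (G.lapMatrix_indicatorComb_le hS y).trans ?_
  rw [sum_indicatorComb_sq hS, Finset.mul_sum]
  refine Finset.sum_le_sum fun i _ => ?_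
  have h1 : (G.cut (S i) : ℝ) ≤ B := by exact_mod_cast hB i
  have h2 : (N : ℝ) + 1 ≤ (S i).card := by exact_mod_cast hN i
  have h3 : (0 : ℝ) < N + 1 := by positivity
  calc 2 * y i ^ 2 * (G.cut (S i)) ≤ 2 * y i ^ 2 * B := by gcongr
    _ = 2 * B / (N + 1) * ((N + 1) * y i ^ 2) := by field_simp
    _ ≤ _ := by gcongr

theorem le_adjEigenvalue (G : SimpleGraph V) [DecidableRel G.Adj] {m : ℕ} (hm : 1 ≤ m)
    {S : Fin m → Finset V} (hS : ∀ i j, i ≠ j → Disjoint (S i) (S j))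
    (hN : ∀ i, G.minDegree + 1 ≤ (S i).card) {B : ℕ} (hB : ∀ i, G.cut (S i) ≤ B) :
    (G.minDegree : ℝ) - 2 * B / (G.minDegree + 1) ≤ G.adjEigenvalue m := by
  refine le_ithLargestEigenvalue _ hm (indicatorComb S) (indicatorComb_injective
    (fun i => Finset.card_pos.mp (by have := hN i; omega)) hS) _ fun y => ?_
  have h1 := G.lapMatrix_indicatorComb_le_of_cut_le hS hN hB y
  have h2 := G.mul_le_degMatrix (indicatorComb S y)
  rw [lapMatrix, sub_mulVec, dotProduct_sub] at h1
  linarith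

theorem le_signlessLapEigenvalue (G : SimpleGraph V) [DecidableRel G.Adj] {m : ℕ} (hm : 1 ≤ m)
    {S : Fin m → Finset V} (hS : ∀ i j, i ≠ j → Disjoint (S i) (S j))
    (hN : ∀ i, G.minDegree + 1 ≤ (S i).card) {B : ℕ} (hB : ∀ i, G.cut (S i) ≤ B) :
    2 * (G.minDegree : ℝ) - 2 * B / (G.minDegree + 1) ≤ G.signlessLapEigenvalue m := by
  refine le_ithLargestEigenvalue _ hm (indicatorComb S) (indicatorComb_injective
    (fun i => Finset.card_pos.mp (by have := hN i; omega)) hS) _ fun y => ?_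
  have h1 := G.lapMatrix_indicatorComb_le_of_cut_le hS hN hB y
  have h2 := G.mul_le_degMatrix (indicatorComb S y)
  rw [lapMatrix, sub_mulVec, dotProduct_sub] at h1
  rw [signlessLapMatrix, add_mulVec, dotProduct_add]
  linarith

end Spectral

/-! ### Reduction to k + 1 spanning trees, and the numerical comparison -/

theorem propertyP_of_exists_spanning_trees {V : Type*} [Fintype V] [Nontrivial V] (G : SimpleGraph V)
    {k d : ℕ} (hd : 0 < d)
    {T : Fin (k + 1) → SimpleGraph V} (hT : ∀ i, T i ≤ G ∧ (T i).IsTree)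
    (hdisj : ∀ i j, i ≠ j → Disjoint (T i).edgeSet (T j).edgeSet) : G.PropertyP k d := by
  -- The last tree serves as F, so the component condition is vacuous; the strict edge bound needs
  -- at least two vertices.
  refine ⟨fun i => T i.castSucc, T (Fin.last k), fun i => hT _,
    fun i j hij => hdisj _ _ fun h => hij (Fin.castSucc_injective k h), (hT _).1,
    (hT _).2.isAcyclic, fun i => hdisj _ _ (Fin.castSucc_lt_last i).ne', ?_,
    fun h => (h (hT _).2).elim⟩
  have h1 := (hT (Fin.last k)).2.ncard_edgeSet_add_one
  rw [Nat.card_eq_fintype_card] at h1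
  have h2 : ((T (Fin.last k)).edgeSet.ncard : ℝ) = Fintype.card V - 1 := by
    rw [← h1]
    simp
  have h3 : (0 : ℝ) < Fintype.card V - 1 := by
    have : (1 : ℝ) < Fintype.card V := by exact_mod_cast Fintype.one_lt_card
    linarith
  have h4 : ((d : ℝ) - 1) / d < 1 := by
    have : (0 : ℝ) < d := by exact_mod_cast hd
    rw [div_lt_one this]
    linarith
  rw [h2]
  exact mul_lt_of_lt_one_left h3 h4

theorem two_mul_div_le_nine_mul_div {k δ : ℕ} (hδ : 2 ≤ δ) (hk : 2 ≤ k) :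
    2 * ((4 * k + 3 : ℕ) : ℝ) / ((δ : ℝ) + 1)
      ≤ 9 * ((k : ℝ) + ((δ : ℝ) - 1) / δ) / ((δ : ℝ) + 1) := by
  have hδ' : (2 : ℝ) ≤ δ := by exact_mod_cast hδ
  have hk' : (2 : ℝ) ≤ k := by exact_mod_cast hk
  have h : (1 : ℝ) / 2 ≤ ((δ : ℝ) - 1) / δ := by
    rw [div_le_div_iff₀ (by norm_num) (by linarith)]
    linarith
  refine div_le_div_of_nonneg_right ?_ (by linarith)
  push_cast
  -- 8k + 6 ≤ 9k + 9/2 because k ≥ 2.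
  linarith

/-! ### Edge cuts and the combinatorial core -/

section Cuts

variable {V : Type*} [Fintype V] [DecidableEq V] (G : SimpleGraph V) [DecidableRel G.Adj]

theorem cut_eq_sum_card (S : Finset V) :
    G.cut S = ∑ v ∈ S, (Finset.univ.filter fun u => G.Adj v u ∧ u ∉ S).card := by
  rw [cut, numEdgesBetween, interedges_def, Finset.card_filter, Finset.sum_product]
  refine Finset.sum_congr rfl fun v _ => ?_
  rw [← Finset.card_filter]
  congr 1
  ext u
  simp [and_comm]

theorem cut_compl (S : Finset V) : G.cut (Finset.univ \ S) = G.cut S := by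
  rw [cut, cut, numEdgesBetween, numEdgesBetween, Finset.sdiff_sdiff_eq_self (Finset.subset_univ S)]
  have : Std.Symm G.Adj := G.symm
  exact Rel.card_interedges_comm (r := G.Adj) _ _

theorem cut_le_add {A B C : Finset V}
    (h : ∀ u v, u ∈ C → v ∉ C → (u ∈ A ∧ v ∉ A) ∨ (u ∈ B ∧ v ∉ B)) :
    G.cut C ≤ G.cut A + G.cut B := by
  refine (Finset.card_le_card fun e he => ?_).trans (Finset.card_union_le _ _)
  simp only [mem_interedges_iff, Finset.mem_sdiff, Finset.mem_univ, true_and,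
    Finset.mem_union] at he ⊢
  rcases h _ _ he.1 he.2.1 with h | h
  exacts [Or.inl ⟨h.1, h.2, he.2.2⟩, Or.inr ⟨h.1, h.2, he.2.2⟩]

theorem cut_union_le (A B : Finset V) : G.cut (A ∪ B) ≤ G.cut A + G.cut B :=
  G.cut_le_add fun u v hu hv => by
    simp only [Finset.mem_union, not_or] at hu hv
    tauto

theorem cut_inter_le (A B : Finset V) : G.cut (A ∩ B) ≤ G.cut A + G.cut B :=
  G.cut_le_add fun u v hu hv => by
    simp only [Finset.mem_inter] at hu hv
    tauto

theorem cut_sdiff_le (A B : Finset V) : G.cut (A \ B) ≤ G.cut A + G.cut B := by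
  have h : A \ B = A ∩ (Finset.univ \ B) := by
    ext
    simp
  rw [← G.cut_compl B, h]
  exact G.cut_inter_le A _

/-- Each vertex of S has at most |S| - 1 neighbours in S, hence at least δ + 1 - |S| outside. -/
theorem card_mul_le_cut_add_sq (S : Finset V) :
    S.card * (G.minDegree + 1) ≤ G.cut S + S.card ^ 2 := by
  rw [cut_eq_sum_card]
  have h : ∀ v ∈ S, G.minDegree + 1
      ≤ (Finset.univ.filter fun u => G.Adj v u ∧ u ∉ S).card + S.card := by
    intro v hv
    have h1 := G.minDegree_le_degree v
    have h2 : G.neighborFinset v ⊆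
        (Finset.univ.filter fun u => G.Adj v u ∧ u ∉ S) ∪ S.erase v := by
      intro u hu
      rw [mem_neighborFinset] at hu
      by_cases huS : u ∈ S <;> simp [hu, huS, hu.ne']
    have h3 := (Finset.card_le_card h2).trans (Finset.card_union_le _ _)
    have h4 := Finset.card_erase_add_one hv
    rw [card_neighborFinset_eq_degree] at h3
    omega
  have := Finset.sum_le_sum h
  simp only [Finset.sum_const, smul_eq_mul, Finset.sum_add_distrib] at this
  rw [sq]
  exact this

theorem minDegree_lt_card_of_cut_lt {S : Finset V} (hS : S.Nonempty)
    (h : G.cut S < G.minDegree) : G.minDegree + 1 ≤ S.card := by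
  by_contra hlt
  have h1 := G.card_mul_le_cut_add_sq S
  have h2 := hS.card_pos
  obtain ⟨t, ht⟩ : ∃ t, G.minDegree + 1 = S.card + (t + 1) :=
    ⟨G.minDegree - S.card, by omega⟩
  rw [ht, sq] at h1
  nlinarith

/-- The concave lower bound |S|(δ + 1 - |S|) for the cut is at least 2(δ - 1) when 2 ≤ |S| ≤ δ - 1.
-/
theorem card_eq_one_or_of_cut_lt {S : Finset V} (hS : S.Nonempty) (hle : S.card ≤ G.minDegree)
    (h : G.cut S < 2 * (G.minDegree - 1)) : S.card = 1 ∨ S.card = G.minDegree := by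
  by_contra! hne
  have h1 := G.card_mul_le_cut_add_sq S
  have h2 := hS.card_pos
  obtain ⟨s, hs⟩ : ∃ s, S.card = s + 2 := ⟨S.card - 2, by omega⟩
  obtain ⟨t, ht⟩ : ∃ t, G.minDegree = S.card + (t + 1) :=
    ⟨G.minDegree - S.card - 1, by omega⟩
  have h3 : 2 * (G.minDegree - 1) = 2 * (s + t + 2) := by omega
  rw [h3] at h
  rw [ht, hs] at h1
  nlinarith

theorem edgeConnectivity_le_cut {S : Finset V} (hS : S.Nonempty) (hS' : S ≠ Finset.univ) :
    G.edgeConnectivity ≤ G.cut S := by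
  let X : Finset (Sym2 V) := (G.interedges S (Finset.univ \ S)).image fun e => s(e.1, e.2)
  have hX : X.card ≤ G.cut S := Finset.card_image_le
  refine le_trans (Nat.sInf_le ⟨X, ?_, rfl, fun hc => ?_⟩) hX
  · intro e he
    obtain ⟨⟨a, b⟩, hab, rfl⟩ := Finset.mem_image.mp he
    rw [mem_interedges_iff] at hab
    exact hab.2.2
  · obtain ⟨u, hu⟩ := hS
    obtain ⟨v, hv⟩ : ∃ v, v ∉ S := by
      by_contra! h
      exact hS' (Finset.eq_univ_iff_forall.mpr h)
    obtain ⟨p⟩ := hc.preconnected u v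
    obtain ⟨d, -, hd1, hd2⟩ := p.exists_boundary_dart (S : Set V) hu hv
    have hd := d.adj
    rw [deleteEdges_adj] at hd
    refine hd.2 (Finset.mem_coe.mpr (Finset.mem_image.mpr ⟨d.toProd, ?_, rfl⟩))
    rw [mem_interedges_iff]
    exact ⟨hd1, by simpa using hd2, hd.1⟩

theorem sum_cut_fiber {s : ℕ} (f : V → Fin s) :
    ∑ j, G.cut (Finset.univ.filter fun v => f v = j) = 2 * (G.crossGraph f).edgeSet.ncard := by
  classical
  have h := (G.crossGraph f).sum_degrees_eq_twice_card_edges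
  rw [← coe_edgeFinset, Set.ncard_coe_finset, ← h, ← Finset.sum_fiberwise _ f]
  refine Finset.sum_congr rfl fun j _ => ?_
  rw [cut_eq_sum_card]
  refine Finset.sum_congr rfl fun v hv => ?_
  rw [← card_neighborFinset_eq_degree]
  congr 1
  ext u
  have hv' : f v = j := by simpa using hv
  rw [mem_neighborFinset]
  simp [crossGraph, ← hv', eq_comm]

theorem mul_pred_le_card_crossGraph {k κ : ℕ} (hk : 2 ≤ k) (hδ : 3 * k + 3 ≤ G.minDegree)
    (hκ : ∀ S : Finset V, S.Nonempty → S ≠ Finset.univ → κ ≤ G.cut S)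
    {W : Fin 3 → Finset V} (hWne : ∀ i, (W i).Nonempty)
    (hWd : ∀ i j, i ≠ j → Disjoint (W i) (W j)) (hWcut : ∀ i, G.cut (W i) = κ)
    (hR : (Finset.univ \ Finset.univ.biUnion W).Nonempty)
    (H : ∀ S : Fin 4 → Finset V, (∀ i j, i ≠ j → Disjoint (S i) (S j)) →
      (∀ i, G.minDegree + 1 ≤ (S i).card) → ¬ ∀ i, G.cut (S i) ≤ 4 * k + 3)
    {s : ℕ} {f : V → Fin s} (hf : Function.Surjective f) :
    (k + 1) * (s - 1) ≤ (G.crossGraph f).edgeSet.ncard := by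
  by_contra hlt
  obtain ⟨q, rfl⟩ : ∃ q, s = q + 1 := by
    refine ⟨s - 1, ?_⟩
    rcases s with _ | s
    · simp at hlt
    · rfl
  have hq : q ≠ 0 := by
    rintro rfl
    simp at hlt
  let P : Fin (q + 1) → Finset V := fun j => Finset.univ.filter fun v => f v = j
  have hPmem : ∀ v j, v ∈ P j ↔ f v = j := fun v j => by simp [P]
  have hPd : ∀ i j, i ≠ j → Disjoint (P i) (P j) := fun i j hij =>
    Finset.disjoint_left.mpr fun v hi hj => hij (((hPmem v i).mp hi).symm.trans ((hPmem v j).mp hj))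
  have hPne : ∀ j, (P j).Nonempty := fun j => (hf j).imp fun v hv => (hPmem v j).mpr hv
  have hPcut : ∀ j, κ ≤ G.cut (P j) := by
    refine fun j => hκ _ (hPne j) fun h => ?_
    have : Nontrivial (Fin (q + 1)) := Fin.nontrivial_iff_two_le.mpr (by omega)
    obtain ⟨j', hj'⟩ := exists_ne j
    obtain ⟨v, hv⟩ := hf j'
    exact hj' (hv.symm.trans ((hPmem v j).mp (h ▸ Finset.mem_univ v)))
  have hsum : ∑ j, G.cut (P j) + 2 ≤ 2 * ((k + 1) * q) := by
    have := G.sum_cut_fiber f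
    simp only [Nat.add_sub_cancel] at hlt
    simp only [P]
    omega
  -- As 3k + 2 < δ, classes in J have at least δ + 1 vertices; the others have boundary at least 3(k
  -- + 1).
  let J : Finset (Fin (q + 1)) := Finset.univ.filter fun j => G.cut (P j) ≤ 3 * k + 2
  have hJ : J.card ≤ 3 := by
    by_contra hJ
    obtain ⟨e⟩ : Nonempty (Fin 4 ↪ J) :=
      Function.Embedding.nonempty_of_card_le (by simp; omega)
    have he : ∀ i, G.cut (P (e i)) ≤ 3 * k + 2 := fun i => (Finset.mem_filter.mp (e i).2).2
    refine H (fun i => P (e i)) (fun i j hij => hPd _ _ fun h => hij (e.injective (Subtype.ext h)))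
      (fun i => G.minDegree_lt_card_of_cut_lt (hPne _) ?_) fun i => ?_ <;>
    · have := he i
      omega
  have hJs : J.card ≤ q + 1 := by simpa using Finset.card_le_univ J
  have hlow : J.card * κ + (q + 1) * (3 * k + 3)
      ≤ ∑ j, G.cut (P j) + J.card * (3 * k + 3) := by
    have : ∑ j : Fin (q + 1), ((if j ∈ J then κ else 0) + (3 * k + 3))
        ≤ ∑ j, (G.cut (P j) + if j ∈ J then 3 * k + 3 else 0) := by
      refine Finset.sum_le_sum fun j _ => ?_
      have h1 := hPcut j
      by_cases hj : j ∈ J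
      · simp only [hj, if_true]
        omega
      · have h2 : ¬ G.cut (P j) ≤ 3 * k + 2 := by simpa [J] using hj
        simp only [hj, if_false]
        omega
    simpa [Finset.sum_add_distrib] using this
  have hmain : J.card * κ + (k + 1) * q + 3 * (k + 1) + 2 ≤ J.card * (3 * (k + 1)) := by
    nlinarith
  -- |J| ≤ 1 is impossible, |J| = 2 gives κ ≤ k, and |J| = 3 gives the bound itself.
  have h3κ : 3 * κ ≤ 4 * k + 2 := by
    generalize J.card = t at *
    have hq' : (k + 1) * t ≤ (k + 1) * (q + 1) := Nat.mul_le_mul_left _ hJs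
    interval_cases t <;> nlinarith
  set R := Finset.univ \ Finset.univ.biUnion W with hRdef
  have hRmem : ∀ v, v ∈ R ↔ ∀ i, v ∉ W i := fun v => by simp [hRdef]
  have hRd : ∀ i, Disjoint (W i) R := fun i =>
    Finset.disjoint_left.mpr fun v hv hvR => (hRmem v).mp hvR i hv
  have hRcut : G.cut R ≤ 3 * κ := by
    have h1 : Finset.univ.biUnion W = W 0 ∪ W 1 ∪ W 2 := by
      ext v
      simp [Fin.exists_fin_succ]
    rw [hRdef, cut_compl, h1]
    have h2 := G.cut_union_le (W 0 ∪ W 1) (W 2)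
    have h3 := G.cut_union_le (W 0) (W 1)
    simp only [hWcut] at h2 h3
    omega
  have hWcard : ∀ i, G.minDegree + 1 ≤ (W i).card := fun i =>
    G.minDegree_lt_card_of_cut_lt (hWne i) (by rw [hWcut]; omega)
  have hRcard : R.card ≤ G.minDegree := by
    by_contra hlt
    refine H (Fin.cons R W) ?_ ?_ ?_
    · intro i j
      refine Fin.cases ?_ (fun i => ?_) i <;> refine Fin.cases ?_ (fun j => ?_) j
      · simp
      · exact fun _ => (hRd j).symm
      · exact fun _ => hRd i
      · simpa using hWd i j
    · refine Fin.cases ?_ fun i => ?_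
      · simp only [Fin.cons_zero]
        omega
      · simpa using hWcard i
    · refine Fin.cases ?_ fun i => ?_
      · simp only [Fin.cons_zero]
        omega
      · simp only [Fin.cons_succ, hWcut]
        omega
  have hRcut' : G.minDegree ≤ G.cut R := by
    by_contra hlt
    have := G.minDegree_lt_card_of_cut_lt hR (not_le.mp hlt)
    omega
  have hκk : k + 1 ≤ κ := by omega
  -- κ ≥ k + 1 leaves only |J| = 3, so q ≥ 2, and `hmain` then excludes q ≥ 3.
  obtain rfl : q = 2 := by
    generalize J.card = t at *
    have h3 : t = 3 := by
      have hq' : (k + 1) * t ≤ (k + 1) * (q + 1) := Nat.mul_le_mul_left _ hJs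
      interval_cases t <;> nlinarith
    subst h3
    by_contra hne
    have : 3 ≤ q := by omega
    nlinarith
  have hPcut' : ∀ j, G.cut (P j) + 2 * κ ≤ 4 * k + 2 := by
    rw [Fin.sum_univ_three] at hsum
    have h0 := hPcut 0
    have h1 := hPcut 1
    have h2 := hPcut 2
    intro j
    fin_cases j <;> simp only [Fin.zero_eta, Fin.mk_one, Fin.reduceFinMk] <;> omega
  have hPcard : ∀ j, G.minDegree + 1 ≤ (P j).card := fun j =>
    G.minDegree_lt_card_of_cut_lt (hPne j) (by have := hPcut' j; omega)
  -- If W i met two classes, both pieces would have boundary at most 4k + 2 - κ < δ and so be large;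
  -- with the other two W's they would form four forbidden sets.
  have hmeet : ∀ i, ∀ u ∈ W i, ∀ v ∈ W i, f u = f v := by
    intro i u hu v hv
    by_contra hne
    obtain ⟨i₁, i₂, h1, h2, h12⟩ : ∃ i₁ i₂ : Fin 3, i ≠ i₁ ∧ i ≠ i₂ ∧ i₁ ≠ i₂ := by
      clear hu hv
      revert i
      decide
    have hcut : ∀ j, G.cut (W i ∩ P j) ≤ 3 * k + 2 := fun j => by
      have h1 := G.cut_inter_le (W i) (P j)
      have h2 := hPcut' j
      rw [hWcut] at h1
      omega
    have hcard : ∀ w ∈ W i, G.minDegree + 1 ≤ (W i ∩ P (f w)).card := fun w hw =>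
      G.minDegree_lt_card_of_cut_lt ⟨w, Finset.mem_inter.mpr ⟨hw, (hPmem w _).mpr rfl⟩⟩
        (by have := hcut (f w); omega)
    have hd : Disjoint (W i ∩ P (f u)) (W i ∩ P (f v)) :=
      (hPd _ _ hne).mono Finset.inter_subset_right Finset.inter_subset_right
    have hd' : ∀ i' j, i ≠ i' → Disjoint (W i ∩ P j) (W i') := fun i' j h =>
      (hWd i i' h).mono_left Finset.inter_subset_left
    refine H ![W i ∩ P (f u), W i ∩ P (f v), W i₁, W i₂] ?_ ?_ ?_
    · intro a b hab
      fin_cases a <;> fin_cases b <;>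
        first
        | exact absurd rfl hab
        | simp [hd, hd.symm, hd' _ _ h1, hd' _ _ h2, (hd' _ _ h1).symm, (hd' _ _ h2).symm,
            hWd _ _ h12, hWd _ _ h12.symm]
    · intro a
      fin_cases a
      exacts [hcard u hu, hcard v hv, hWcard i₁, hWcard i₂]
    · intro a
      have h1 := hcut (f u)
      have h2 := hcut (f v)
      fin_cases a <;> simp [hWcut] <;> omega
  choose w hw using hWne
  have hWP : ∀ i, ∀ v ∈ W i, f v = f (w i) := fun i v hv => hmeet i v hv _ (hw i)
  have hsurj : Function.Surjective fun i => f (w i) := by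
    intro j
    by_contra! hj
    have hsub : P j ⊆ R := fun v hv => (hRmem v).mpr fun i hi =>
      hj i ((hWP i v hi).symm.trans ((hPmem v j).mp hv))
    have h1 := Finset.card_le_card hsub
    have h2 := hPcard j
    omega
  have hinj : Function.Injective fun i => f (w i) := Finite.injective_iff_surjective.mpr hsurj
  -- The boundary of R is below 2(δ - 1), so |R| is 1 or δ. If |R| = δ > 3, some class meets R in at
  -- least two vertices; that intersection also has boundary below 2(δ - 1), so it is all of R.
  obtain ⟨j, hj⟩ : ∃ j, R ⊆ P j := by
    rcases G.card_eq_one_or_of_cut_lt hR hRcard (by omega) with h1 | h1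
    · obtain ⟨r, hr⟩ := Finset.card_eq_one.mp h1
      exact ⟨f r, by simp [hr, hPmem]⟩
    · obtain ⟨j, hj⟩ : ∃ j, 2 ≤ (R ∩ P j).card := by
        by_contra! hle
        have h2 : R.card = ∑ j, (R ∩ P j).card := by
          rw [Finset.card_eq_sum_card_fiberwise (s := R) (f := f) (t := Finset.univ) (by simp)]
          refine Finset.sum_congr rfl fun j _ => ?_
          congr 1
          ext v
          simp [hPmem]
        have h3 := Finset.sum_le_sum fun j (_ : j ∈ Finset.univ) => Nat.le_of_lt_succ (hle j)
        simp only [Finset.sum_const, Finset.card_univ, Fintype.card_fin, smul_eq_mul, ← h2] at h3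
        omega
      refine ⟨j, ?_⟩
      have h2 := G.cut_inter_le R (P j)
      have h3 := hPcut' j
      have h4 : (R ∩ P j).card ≤ R.card := Finset.card_le_card Finset.inter_subset_left
      rcases G.card_eq_one_or_of_cut_lt (S := R ∩ P j) (Finset.card_pos.mp (by omega))
        (by omega) (by omega) with h5 | h5
      · omega
      · exact Finset.inter_eq_left.mp
          (Finset.eq_of_subset_of_card_le Finset.inter_subset_left (by omega))
  obtain ⟨i, rfl⟩ := hsurj j
  have hRe : R = P (f (w i)) \ W i := by
    refine Finset.ext fun v => Iff.trans ?_ Finset.mem_sdiff.symm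
    refine ⟨fun hv => ⟨hj hv, (hRmem v).mp hv i⟩, fun ⟨hv, hvi⟩ => (hRmem v).mpr fun i' hi' => ?_⟩
    have : i' = i := hinj ((hWP i' v hi').symm.trans ((hPmem v _).mp hv))
    exact hvi (this ▸ hi')
  have h1 := G.cut_sdiff_le (P (f (w i))) (W i)
  rw [← hRe, hWcut] at h1
  have h2 := hPcut' (f (w i))
  omega

theorem propertyP_of_forall_four_sets {k : ℕ} (hk : 2 ≤ k) (hδ : 3 * k + 3 ≤ G.minDegree)
    (hG : G.MemClassG 2)
    (H : ∀ S : Fin 4 → Finset V, (∀ i j, i ≠ j → Disjoint (S i) (S j)) →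
      (∀ i, G.minDegree + 1 ≤ (S i).card) → ¬ ∀ i, G.cut (S i) ≤ 4 * k + 3) :
    G.PropertyP k G.minDegree := by
  obtain ⟨W, hW, hWd, hR, hWcut⟩ := hG
  obtain ⟨v, hv⟩ := (hW 0).1
  obtain ⟨u, hu⟩ := (hW 1).1
  have : Nontrivial V :=
    ⟨v, u, fun h => Finset.disjoint_left.mp (hWd 0 1 (by decide)) hv (h ▸ hu)⟩
  obtain ⟨T, hT, hdisj⟩ := exists_edge_disjoint_spanning_trees G (k + 1) fun s f hf =>
    G.mul_pred_le_card_crossGraph hk hδ (fun S => G.edgeConnectivity_le_cut) (fun i => (hW i).1)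
      hWd (fun i => (hWcut i).symm) hR H hf
  exact G.propertyP_of_exists_spanning_trees (by omega) hT hdisj

end Cuts

end SimpleGraph

theorem corollary4p3 {V : Type*} [Fintype V] [DecidableEq V]
    (G : SimpleGraph V) [DecidableRel G.Adj] (k δ : ℕ)
    (hk : 2 ≤ k) (hG : G.MemClassG 2) (hδ : G.minDegree = δ) (hkδ : 3 * k + 3 ≤ δ) :
    (G.adjEigenvalue 4 < (δ : ℝ) - 9 * ((k : ℝ) + ((δ : ℝ) - 1) / δ) / ((δ : ℝ) + 1) →
      G.PropertyP k δ) ∧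
    (G.signlessLapEigenvalue 4 <
        2 * (δ : ℝ) - 9 * ((k : ℝ) + ((δ : ℝ) - 1) / δ) / ((δ : ℝ) + 1) →
      G.PropertyP k δ) := by
  subst hδ
  have hnum := SimpleGraph.two_mul_div_le_nine_mul_div (k := k) (δ := G.minDegree) (by omega) hk
  constructor <;> intro hlt <;>
    refine G.propertyP_of_forall_four_sets hk hkδ hG fun S hS hcard hcut => ?_
  · linarith [G.le_adjEigenvalue (by norm_num) hS hcard hcut]
  · linarith [G.le_signlessLapEigenvalue (by norm_num) hS hcard hcut]
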